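/- Let $n\ge 1$, $0<m<1$, $R>0$, $\mathfrak m>0$, and let $B_R\subset\mathbb R^n$ be the open ball of radius $R$ centred at $0$. Let $V\in W^{2,\infty}(B_R)$ (identified with its continuous representative on $\overline{B_R}$) satisfy $V(0)=0$ and be radially symmetric and non-decreasing in $|x|$. For $h\ge 0$ put $$\rho_{V+h}(x)=\Big(\tfrac{1-m}{m}\,(V(x)+h)\Big)^{-\frac1{1-m}}\in(0,\infty],\qquad a_{V+h,R}=\int_{B_R}\rho_{V+h}\,dx\in(0,\infty].$$ Let $\mathcal P_{\mathfrak m}(\overline{B_R})$ be the set of non-negative Borel measures on $\overline{B_R}$ of total mass $\mathfrak m$, and $\mathcal P_{\mathfrak m}(\overline{B_R})\cap L^1(B_R)$ the set of non-negative $\rho\in L^1(B_R)$ with $\int_{B_R}\rho=\mathfrak m$, each identified with the measure $\rho\,dx$. Define $$\mathcal F_R[\rho]=\tfrac1{m-1}\int_{B_R}\rho^m\,dx+\int_{B_R}V\rho\,dx,\qquad \widetilde{\mathcal F}_R[\mu]=-\tfrac1{1-m}\int_{B_R}\mu_{ac}^m\,dx+\int_{\overline{B_R}}V\,d\mu,$$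 where $\mu_{ac}$ is the density of the absolutely continuous part of $\mu$ with respect to Lebesgue measure. Then the formula $$\mu_{\infty,\mathfrak m}=\begin{cases}\rho_{V+h} & \text{if } h\ge 0 \text{ is such that } a_{V+h,R}=\mathfrak m,\\ (\mathfrak m-a_{V,R})\,\delta_0+\rho_V & \text{if } a_{V,R}<\mathfrak m\end{cases}$$ determines exactly one measure on $\overline{B_R}$, it belongs to $\mathcal P_{\mathfrak m}(\overline{B_R})$, and: (i) every sequence $(\rho_j)$ in $\mathcal P_{\mathfrak m}(\overline{B_R})\cap L^1(B_R)$ with $\mathcal F_R[\rho_j]\to\inf \mathcal F_R$ (the infimum over that set) converges to $\mu_{\infty,\mathfrak m}$ weakly-$\star$ in the sense of measures, that is, $\int_{B_R}\varphi\rho_j\,dx\to\int_{\overline{B_R}}\varphi\,d\mu_{\infty,\mathfrak m}$ for all $\varphi\in C(\overline{B_R})$; (ii) $\displaystyle \widetilde{\mathcal F}_R[\mu_{\infty,\mathfrak m}]=\min_{\mu\in\mathcal P_{\mathfrak m}(\overline{B_R})}\widetilde{\mathcal F}_R[\mu]=\inf_{\rho\in\mathcal P_{\mathfrak m}(\overline{B_R})\cap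 L^1(B_R)}\mathcal F_R[\rho]$, a finite number, and $\mu_{\infty,\mathfrak m}$ is the only minimiser of $\widetilde{\mathcal F}_R$ in $\mathcal P_{\mathfrak m}(\overline{B_R})$. -/

import Mathlib

open MeasureTheory Set Filter Topology
open scoped ENNReal ContDiff

namespace FastDiffusion

noncomputable section

/-- The Euclidean space `ℝⁿ`. -/
abbrev E (n : ℕ) : Type := EuclideanSpace ℝ (Fin n)

/-- `g` is the weak (distributional) partial derivative `∂ᵢ f` on the open set `U`. -/
def HasWeakPartialDeriv {n : ℕ} (U : Set (E n)) (i : Fin n) (f g : E n → ℝ) : Prop :=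
  LocallyIntegrableOn f U ∧ LocallyIntegrableOn g U ∧
    ∀ φ : E n → ℝ, ContDiff ℝ ∞ φ → HasCompactSupport φ → tsupport φ ⊆ U →
      ∫ x in U, f x * fderiv ℝ φ x (EuclideanSpace.single i 1) = -∫ x in U, g x * φ x

/-- The Sobolev space `W^{2,∞}(U)`: `f` and its weak derivatives of first and second order
are essentially bounded on `U`. -/
def MemW2Infty {n : ℕ} (U : Set (E n)) (f : E n → ℝ) : Prop :=
  MemLp f ∞ (volume.restrict U) ∧
    ∃ (g : Fin n → E n → ℝ) (H : Fin n → Fin n → E n → ℝ),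
      (∀ i, MemLp (g i) ∞ (volume.restrict U) ∧ HasWeakPartialDeriv U i f (g i)) ∧
      (∀ i j, MemLp (H i j) ∞ (volume.restrict U) ∧ HasWeakPartialDeriv U j (g i) (H i j))

/-- The densities `𝒫_𝔪 ∩ L¹(B_R)`: nonnegative integrable functions on `B_R` with
integral `mass`. -/
def densities (n : ℕ) (R mass : ℝ) : Set (E n → ℝ) :=
  {ρ | IntegrableOn ρ (Metric.ball 0 R) ∧ (∀ᵐ x ∂volume.restrict (Metric.ball 0 R), 0 ≤ ρ x) ∧
    ∫ x in Metric.ball 0 R, ρ x = mass}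

/-- `𝒫_𝔪`: nonnegative Borel measures carried by the closed ball, of total mass `mass`. -/
def measures (n : ℕ) (R mass : ℝ) : Set (Measure (E n)) :=
  {μ | μ (Metric.closedBall 0 R)ᶜ = 0 ∧ μ univ = ENNReal.ofReal mass}

/-- The free energy `ℱ_R[ρ] = 1/(m-1) ∫_{B_R} ρ^m + ∫_{B_R} V ρ`. -/
def freeEnergy {n : ℕ} (m R : ℝ) (V ρ : E n → ℝ) : ℝ :=
  1 / (m - 1) * (∫ x in Metric.ball 0 R, ρ x ^ m) + ∫ x in Metric.ball 0 R, V x * ρ x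

/-- The relaxed free energy `-1/(1-m) ∫_{B_R} μ_ac^m + ∫ V dμ`, where `μ_ac` is the density of
the absolutely continuous part of `μ` (with respect to Lebesgue measure). -/
def relaxedEnergy {n : ℕ} (m R : ℝ) (V : E n → ℝ) (μ : Measure (E n)) : ℝ :=
  -(1 / (1 - m)) * (∫ x in Metric.ball 0 R, (μ.rnDeriv volume x).toReal ^ m)
    + ∫ x in Metric.closedBall 0 R, V x ∂μ

/-- The stationary profile `ρ_{V+h} = ((1-m)/m (V+h))^{-1/(1-m)}`, with the value `∞`
where `V + h = 0`. -/
def profile {n : ℕ} (m : ℝ) (V : E n → ℝ) (h : ℝ) (x : E n) : ℝ≥0∞ :=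
  ENNReal.ofReal ((1 - m) / m * (V x + h)) ^ (-(1 / (1 - m)))

/-- The mass `a_{V+h,R} = ∫_{B_R} ρ_{V+h}`, possibly infinite. -/
def profileMass {n : ℕ} (m R : ℝ) (V : E n → ℝ) (h : ℝ) : ℝ≥0∞ :=
  ∫⁻ x in Metric.ball 0 R, profile m V h x

/-- The measure on `B_R` with density `ρ_{V+h}`. -/
def profileMeasure {n : ℕ} (m R : ℝ) (V : E n → ℝ) (h : ℝ) : Measure (E n) :=
  (volume.restrict (Metric.ball 0 R)).withDensity (profile m V h)

/-- `μ` is the measure `μ_{∞,𝔪}`: it is `ρ_{V+h}` if `h ≥ 0` satisfies `a_{V+h,R} = 𝔪`, and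
`(𝔪 - a_{V,R}) δ₀ + ρ_V` if `a_{V,R} < 𝔪`. -/
def IsMuInfty {n : ℕ} (m R mass : ℝ) (V : E n → ℝ) (μ : Measure (E n)) : Prop :=
  (∃ h : ℝ, 0 ≤ h ∧ profileMass m R V h = ENNReal.ofReal mass ∧ μ = profileMeasure m R V h) ∨
  (profileMass m R V 0 < ENNReal.ofReal mass ∧
    μ = (ENNReal.ofReal mass - profileMass m R V 0) • Measure.dirac 0 + profileMeasure m R V 0)

/-- `ρ_j` is a minimising sequence of `ℱ_R` over the densities of mass `mass`. -/
def IsMinimisingSeq {n : ℕ} (m R mass : ℝ) (V : E n → ℝ) (ρ : ℕ → E n → ℝ) : Prop :=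
  (∀ j, ρ j ∈ densities n R mass) ∧
    Tendsto (fun j => freeEnergy m R V (ρ j)) atTop
      (𝓝 (sInf (freeEnergy m R V '' densities n R mass)))

/-- Weak-⋆ convergence, in duality with the continuous functions on the closed ball, of the
measures `ρ_j dx` on `B_R` to `μ`. -/
def TendstoWeakStar {n : ℕ} (R : ℝ) (ρ : ℕ → E n → ℝ) (μ : Measure (E n)) : Prop :=
  ∀ φ : E n → ℝ, ContinuousOn φ (Metric.closedBall 0 R) →
    Tendsto (fun j => ∫ x in Metric.ball 0 R, φ x * ρ j x) atTop
      (𝓝 (∫ x in Metric.closedBall 0 R, φ x ∂μ))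

end

end FastDiffusion

/-! At fixed mass, replacing `V` by `w = V + h` only adds the constant `h * mass` to both energies.
So `h` acts as a Lagrange multiplier, and the problem becomes the pointwise minimisation of `s ↦ -s
^ m / (1 - m) + w s`, a strictly convex function whose minimiser is `p = equilibrium m w`. A
singular part contributes `∫ w ≥ 0`. Hence `∫ energyDensity m w p` bounds the shifted relaxed energy
from below. `μ_∞` attains this bound: any atom of mass `c` sits at `0` and satisfies `c * w 0 = 0`,
so it is free. Equality forces the absolutely continuous density to be `p` and the singular part to
live where `w = 0`, hence at the origin; the total mass then fixes the atom. Spreading the atom over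
small balls shows that densities have the same infimum.

Convergence of minimising sequences needs no compactness. The pointwise excess equals `w p / m`
times the Bernoulli defect of `s / p` (`energyDensity_sub_equilibrium`), so the excess energy
controls `∫ w |ρ - p|` (`integral_mul_abs_sub_equilibrium_le`). The weight can degenerate only at
`0`. Since `ρ` has mass `c + ∫ p`, a test function `φ` may be replaced by `φ - φ 0`, which is
bounded by `ε + C w` (`IsConfining.exists_abs_sub_le`).

The multiplier exists because the profile mass decreases continuously to `0` on `h > 0` and recovers
its value at `h = 0` by monotone convergence. If it stays below `mass` even at `h = 0`, the missing
mass becomes the atom. -/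

namespace FastDiffusion

/-! ### Scalar convexity: the pointwise energy and its minimiser. -/

/-- The Bernoulli defect `1 + m (t - 1) - t ^ m`. -/
noncomputable def bernoulliDefect (m t : ℝ) : ℝ := 1 - t ^ m + m * (t - 1)

theorem bernoulliDefect_nonneg {m t : ℝ} (hm0 : 0 < m) (hm1 : m < 1) (ht : 0 ≤ t) :
    0 ≤ bernoulliDefect m t := by
  have := rpow_one_add_le_one_add_mul_self (s := t - 1) (p := m) (by linarith) hm0.le hm1.le
  rw [add_sub_cancel] at this
  unfold bernoulliDefect; linarith

theorem bernoulliDefect_pos {m t : ℝ} (hm0 : 0 < m) (hm1 : m < 1) (ht : 0 ≤ t) (h1 : t ≠ 1) :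
    0 < bernoulliDefect m t := by
  have := rpow_one_add_lt_one_add_mul_self (s := t - 1) (p := m) (by linarith)
    (sub_ne_zero.2 h1) hm0 hm1
  rw [add_sub_cancel] at this
  unfold bernoulliDefect; linarith

theorem convexOn_bernoulliDefect {m : ℝ} (hm0 : 0 < m) (hm1 : m < 1) :
    ConvexOn ℝ (Ici 0) (bernoulliDefect m) := by
  refine ⟨convex_Ici 0, fun x hx y hy a b ha hb hab => ?_⟩
  have := (Real.concaveOn_rpow hm0.le hm1.le).2 hx hy ha hb hab
  simp only [smul_eq_mul, bernoulliDefect] at this ⊢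
  obtain rfl : b = 1 - a := by linarith
  nlinarith

/-- The defect is convex, vanishes at `1` and is positive elsewhere, so it grows at least linearly
away from `1`. The slack `δ` absorbs its flatness near `1`. -/
theorem abs_sub_one_le_bernoulliDefect {m δ : ℝ} (hm0 : 0 < m) (hm1 : m < 1) (hδ : 0 < δ) :
    ∃ C, 0 ≤ C ∧ ∀ t, 0 ≤ t → |t - 1| ≤ δ + C * bernoulliDefect m t := by
  -- The cap `1 / 2` keeps `1 - l` in the domain `[0, ∞)` of the defect.
  set l := min δ (1 / 2) with hl
  have hl0 : 0 < l := lt_min hδ (by norm_num)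
  have hl1 : l ≤ 1 / 2 := min_le_right _ _
  have hlδ : l ≤ δ := min_le_left _ _
  have key : ∀ u, 0 ≤ u → u ≠ 1 → |u - 1| = l → ∀ t, 0 ≤ t → l ≤ |t - 1| →
      0 ≤ (t - 1) * (u - 1) →
      |t - 1| ≤ l / bernoulliDefect m u * bernoulliDefect m t := by
    intro u hu hu1 hul t ht htl hs
    have hpos : 0 < |t - 1| := hl0.trans_le htl
    have hu0 := bernoulliDefect_pos hm0 hm1 hu hu1
    -- `u` lies between `1` and `t`, with weight `l / |t - 1|` on `t`; convexity bounds the defect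
    -- at `u` by that fraction of the defect at `t`.
    have hc := (convexOn_bernoulliDefect hm0 hm1).2 (show (1 : ℝ) ∈ Ici 0 by simp)
      (show t ∈ Ici 0 from ht)
      (show 0 ≤ 1 - l / |t - 1| by rw [sub_nonneg, div_le_one hpos]; exact htl)
      (show 0 ≤ l / |t - 1| by positivity) (by ring)
    have e1 : bernoulliDefect m 1 = 0 := by simp [bernoulliDefect]
    have e2 : (1 - l / |t - 1|) • (1 : ℝ) + (l / |t - 1|) • t = u := by
      simp only [smul_eq_mul]
      have : l / |t - 1| * (t - 1) = u - 1 := by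
        rw [← hul, div_mul_eq_mul_div, div_eq_iff hpos.ne', mul_comm (u - 1)]
        rcases lt_or_gt_of_ne (abs_pos.1 hpos) with h | h
        · have : u - 1 ≤ 0 := by nlinarith
          rw [abs_of_nonpos this, abs_of_neg h]; ring
        · have : 0 ≤ u - 1 := by nlinarith
          rw [abs_of_nonneg this, abs_of_pos h]; ring
      linarith
    rw [e1, e2, smul_zero, zero_add, smul_eq_mul, div_mul_eq_mul_div, le_div_iff₀ hpos] at hc
    rw [div_mul_eq_mul_div, le_div_iff₀ hu0, mul_comm]
    exact hc
  have h1 := bernoulliDefect_pos hm0 hm1 (t := 1 + l) (by linarith) (by linarith)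
  have h2 := bernoulliDefect_pos hm0 hm1 (t := 1 - l) (by linarith) (by linarith)
  refine ⟨l / bernoulliDefect m (1 + l) + l / bernoulliDefect m (1 - l), by positivity, ?_⟩
  intro t ht
  have ht0 := bernoulliDefect_nonneg hm0 hm1 ht
  have q1 : 0 ≤ l / bernoulliDefect m (1 + l) * bernoulliDefect m t := by positivity
  have q2 : 0 ≤ l / bernoulliDefect m (1 - l) * bernoulliDefect m t := by positivity
  rw [add_mul]
  by_cases hc : |t - 1| ≤ l
  · linarith
  push Not at hc
  rcases le_total t 1 with h | h
  · have := key (1 - l) (by linarith) (by linarith) (by simp [abs_of_pos hl0]) t ht hc.le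
      (by nlinarith)
    linarith
  · have := key (1 + l) (by linarith) (by linarith) (by simp [abs_of_pos hl0]) t ht hc.le
      (by nlinarith)
    linarith

/-- The integrand `- s ^ m / (1 - m) + w s` of the free energy. -/
noncomputable def energyDensity (m w s : ℝ) : ℝ := -(1 / (1 - m)) * s ^ m + w * s

/-- The minimiser `((1 - m) / m * w) ^ (- 1 / (1 - m))` of `energyDensity m w`. -/
noncomputable def equilibrium (m w : ℝ) : ℝ := ((1 - m) / m * w) ^ (-(1 / (1 - m)))

theorem equilibrium_pos {m w : ℝ} (hm0 : 0 < m) (hm1 : m < 1) (hw : 0 < w) :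
    0 < equilibrium m w := by
  have : 0 < 1 - m := by linarith
  unfold equilibrium; positivity

/-- This is the Euler–Lagrange equation `m / (1 - m) * p ^ (m - 1) = w`, multiplied by `p`. -/
theorem equilibrium_rpow {m w : ℝ} (hm0 : 0 < m) (hm1 : m < 1) (hw : 0 < w) :
    equilibrium m w ^ m = (1 - m) / m * w * equilibrium m w := by
  have h1 : 0 < 1 - m := by linarith
  have hb : 0 < (1 - m) / m * w := by positivity
  unfold equilibrium
  rw [← Real.rpow_mul hb.le]
  nth_rewrite 2 [← Real.rpow_one ((1 - m) / m * w)]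
  rw [← Real.rpow_add hb]
  congr 1
  field_simp
  ring

theorem energyDensity_sub_equilibrium {m w s : ℝ} (hm0 : 0 < m) (hm1 : m < 1) (hw : 0 < w)
    (hs : 0 ≤ s) :
    energyDensity m w s - energyDensity m w (equilibrium m w) =
      w * equilibrium m w / m * bernoulliDefect m (s / equilibrium m w) := by
  have h1 : 0 < 1 - m := by linarith
  have hp := equilibrium_pos hm0 hm1 hw
  have hpm := equilibrium_rpow hm0 hm1 hw
  set p := equilibrium m w
  have hs' : s ^ m = (s / p) ^ m * p ^ m := by
    rw [← Real.mul_rpow (by positivity) hp.le, div_mul_cancel₀ _ hp.ne']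
  unfold energyDensity bernoulliDefect
  rw [hs', hpm]
  field_simp
  ring

theorem energyDensity_equilibrium_le {m w s : ℝ} (hm0 : 0 < m) (hm1 : m < 1) (hw : 0 < w)
    (hs : 0 ≤ s) : energyDensity m w (equilibrium m w) ≤ energyDensity m w s := by
  have hp := equilibrium_pos hm0 hm1 hw
  rw [← sub_nonneg, energyDensity_sub_equilibrium hm0 hm1 hw hs]
  have := bernoulliDefect_nonneg hm0 hm1 (t := s / equilibrium m w) (by positivity)
  positivity

/-- The scalar bound at `t = s / p`, scaled by `w p`. The constants do not depend on `w`, so the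
estimate can be integrated even where `p` is unbounded. -/
theorem mul_abs_sub_equilibrium_le {m δ : ℝ} (hm0 : 0 < m) (hm1 : m < 1) (hδ : 0 < δ) :
    ∃ C, 0 ≤ C ∧ ∀ w s, 0 < w → 0 ≤ s → w * |s - equilibrium m w| ≤
      δ * (w * equilibrium m w) +
        C * (energyDensity m w s - energyDensity m w (equilibrium m w)) := by
  obtain ⟨C, hC, h⟩ := abs_sub_one_le_bernoulliDefect hm0 hm1 hδ
  refine ⟨C * m, by positivity, fun w s hw hs => ?_⟩
  rw [energyDensity_sub_equilibrium hm0 hm1 hw hs]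
  have hp := equilibrium_pos hm0 hm1 hw
  set p := equilibrium m w
  have e : |s - p| = p * |s / p - 1| := by
    rw [← abs_of_pos hp, ← abs_mul, abs_of_pos hp]; congr 1; field_simp
  rw [e]
  have := mul_le_mul_of_nonneg_left (h (s / p) (by positivity)) (by positivity : 0 ≤ w * p)
  calc w * (p * |s / p - 1|) = w * p * |s / p - 1| := by ring
    _ ≤ _ := this
    _ = _ := by field_simp

end FastDiffusion

/-! ### Integrated energies and the Lebesgue decomposition. -/

namespace FastDiffusion

theorem integrable_rpow {α : Type*} [MeasurableSpace α] {μ : Measure α} [IsFiniteMeasure μ]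
    {m : ℝ} (hm0 : 0 < m) (hm1 : m < 1) {f : α → ℝ} (hf : Integrable f μ)
    (h0 : ∀ᵐ x ∂μ, 0 ≤ f x) : Integrable (fun x => f x ^ m) μ := by
  refine Integrable.mono' (hf.add (integrable_const 1))
    (hf.aestronglyMeasurable.aemeasurable.pow_const m).aestronglyMeasurable ?_
  filter_upwards [h0] with x hx
  rw [Real.norm_of_nonneg (Real.rpow_nonneg hx m)]
  have := bernoulliDefect_nonneg hm0 hm1 hx
  simp only [Pi.add_apply, bernoulliDefect] at this ⊢
  nlinarith

variable {n : ℕ} {m R : ℝ} {w f : E n → ℝ}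

theorem integrableOn_ball_mul (hw : ContinuousOn w (Metric.closedBall 0 R))
    (hf : IntegrableOn f (Metric.ball 0 R)) :
    IntegrableOn (fun x => w x * f x) (Metric.ball 0 R) := by
  obtain ⟨C, hC⟩ := (isCompact_closedBall (0 : E n) R).exists_bound_of_continuousOn hw
  exact Integrable.bdd_mul (c := C) hf
    ((hw.mono Metric.ball_subset_closedBall).aestronglyMeasurable measurableSet_ball)
    (ae_restrict_of_forall_mem measurableSet_ball
      fun x hx => hC x (Metric.ball_subset_closedBall hx))

theorem integrableOn_energyDensity (hm0 : 0 < m) (hm1 : m < 1)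
    (hw : ContinuousOn w (Metric.closedBall 0 R)) (hf : IntegrableOn f (Metric.ball 0 R))
    (h0 : ∀ᵐ x ∂volume.restrict (Metric.ball 0 R), 0 ≤ f x) :
    IntegrableOn (fun x => energyDensity m (w x) (f x)) (Metric.ball 0 R) := by
  have : IsFiniteMeasure (volume.restrict (Metric.ball (0 : E n) R)) :=
    ⟨by simpa using measure_ball_lt_top⟩
  exact ((integrable_rpow hm0 hm1 hf h0).const_mul _).add
    (integrableOn_ball_mul hw hf)

theorem integral_energyDensity (hm0 : 0 < m) (hm1 : m < 1)
    (hw : ContinuousOn w (Metric.closedBall 0 R)) (hf : IntegrableOn f (Metric.ball 0 R))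
    (h0 : ∀ᵐ x ∂volume.restrict (Metric.ball 0 R), 0 ≤ f x) :
    ∫ x in Metric.ball 0 R, energyDensity m (w x) (f x) =
      -(1 / (1 - m)) * (∫ x in Metric.ball 0 R, f x ^ m) + ∫ x in Metric.ball 0 R, w x * f x := by
  have : IsFiniteMeasure (volume.restrict (Metric.ball (0 : E n) R)) :=
    ⟨by simpa using measure_ball_lt_top⟩
  unfold energyDensity
  rw [integral_add ((integrable_rpow hm0 hm1 hf h0).const_mul _)
    (integrableOn_ball_mul hw hf), integral_const_mul]

theorem freeEnergy_eq_integral (hm0 : 0 < m) (hm1 : m < 1)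
    (hw : ContinuousOn w (Metric.closedBall 0 R)) {mass : ℝ} (hf : f ∈ densities n R mass) :
    freeEnergy m R w f = ∫ x in Metric.ball 0 R, energyDensity m (w x) (f x) := by
  rw [integral_energyDensity hm0 hm1 hw hf.1 hf.2.1, freeEnergy,
    show m - 1 = -(1 - m) by ring, one_div_neg_eq_neg_one_div]

theorem ball_ae_eq_closedBall (hR : 0 < R) :
    Metric.ball (0 : E n) R =ᵐ[volume] Metric.closedBall 0 R := by
  refine ae_eq_set.2 ⟨by simp [Set.sdiff_eq_empty.2 Metric.ball_subset_closedBall], ?_⟩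
  rw [Metric.closedBall_sdiff_ball]
  exact Measure.addHaar_sphere_of_ne_zero volume 0 hR.ne'

/-- Splitting `∫ w dν` by the Lebesgue decomposition isolates the cost of the singular part. The
sphere is Lebesgue null, so only the singular part can see the difference between the open and
closed balls. -/
theorem relaxedEnergy_eq (hm0 : 0 < m) (hm1 : m < 1) (hR : 0 < R)
    (hw : ContinuousOn w (Metric.closedBall 0 R)) (ν : Measure (E n)) [IsFiniteMeasure ν] :
    relaxedEnergy m R w ν =
      (∫ x in Metric.ball 0 R, energyDensity m (w x) (ν.rnDeriv volume x).toReal) +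
        ∫ x in Metric.closedBall 0 R, w x ∂(ν.singularPart volume) := by
  have hf : Integrable (fun x => (ν.rnDeriv volume x).toReal) (volume : Measure (E n)) :=
    Measure.integrable_toReal_rnDeriv
  rw [integral_energyDensity hm0 hm1 hw hf.integrableOn (ae_of_all _ fun _ => ENNReal.toReal_nonneg),
    relaxedEnergy, add_assoc]
  congr 1
  have hI : IntegrableOn w (Metric.closedBall 0 R) ν :=
    hw.integrableOn_compact (isCompact_closedBall _ _)
  have hdec := Measure.haveLebesgueDecomposition_add ν volume
  have h1 : IntegrableOn w (Metric.closedBall 0 R) (ν.singularPart volume) :=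
    hI.mono_measure (Measure.singularPart_le _ _)
  have h2 : IntegrableOn w (Metric.closedBall 0 R)
      ((volume : Measure (E n)).withDensity (ν.rnDeriv volume)) :=
    hI.mono_measure (Measure.withDensity_rnDeriv_le _ _)
  nth_rewrite 1 [hdec]
  rw [Measure.restrict_add, integral_add_measure h1 h2, add_comm,
    setIntegral_withDensity_eq_setIntegral_toReal_smul (Measure.measurable_rnDeriv _ _)
      (ae_restrict_of_ae (Measure.rnDeriv_lt_top _ _)) _ Metric.isClosed_closedBall.measurableSet,
    ← setIntegral_congr_set (ball_ae_eq_closedBall hR)]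
  simp only [smul_eq_mul, mul_comm]

/-- A continuous potential on the closed ball which is positive away from the origin. -/
structure IsConfining (R : ℝ) (w : E n → ℝ) : Prop where
  continuousOn : ContinuousOn w (Metric.closedBall 0 R)
  nonneg_zero : 0 ≤ w 0
  pos : ∀ x ∈ Metric.closedBall 0 R, x ≠ 0 → 0 < w x

theorem IsConfining.nonneg (hw : IsConfining R w) {x : E n} (hx : x ∈ Metric.closedBall 0 R) :
    0 ≤ w x := by
  rcases eq_or_ne x 0 with rfl | h
  · exact hw.nonneg_zero
  · exact (hw.pos x hx h).le

theorem IsConfining.ae_pos [Nontrivial (E n)] (hw : IsConfining R w) :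
    ∀ᵐ x ∂volume.restrict (Metric.ball (0 : E n) R), 0 < w x := by
  have h0 : ∀ᵐ x ∂volume.restrict (Metric.ball (0 : E n) R), x ≠ 0 :=
    ae_restrict_of_ae (by simp [ae_iff])
  filter_upwards [h0, ae_restrict_mem measurableSet_ball] with x hx hxB
  exact hw.pos x (Metric.ball_subset_closedBall hxB) hx

theorem IsConfining.ae_equilibrium_pos [Nontrivial (E n)] (hm0 : 0 < m) (hm1 : m < 1)
    (hw : IsConfining R w) :
    ∀ᵐ x ∂volume.restrict (Metric.ball (0 : E n) R), 0 < equilibrium m (w x) :=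
  hw.ae_pos.mono fun _ hx => equilibrium_pos hm0 hm1 hx

/-! ### Excess energy and weighted distance to equilibrium. -/

section Excess

variable [Nontrivial (E n)]

theorem integral_energyDensity_equilibrium_le (hm0 : 0 < m) (hm1 : m < 1) (hw : IsConfining R w)
    (hp : IntegrableOn (fun x => equilibrium m (w x)) (Metric.ball 0 R))
    (hf : IntegrableOn f (Metric.ball 0 R))
    (h0 : ∀ᵐ x ∂volume.restrict (Metric.ball 0 R), 0 ≤ f x) :
    ∫ x in Metric.ball 0 R, energyDensity m (w x) (equilibrium m (w x)) ≤
      ∫ x in Metric.ball 0 R, energyDensity m (w x) (f x) := by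
  refine integral_mono_ae (integrableOn_energyDensity hm0 hm1 hw.continuousOn hp
    ((hw.ae_equilibrium_pos hm0 hm1).mono fun _ h => h.le))
    (integrableOn_energyDensity hm0 hm1 hw.continuousOn hf h0) ?_
  filter_upwards [hw.ae_pos, h0] with x hx hfx
  exact energyDensity_equilibrium_le hm0 hm1 hx hfx

theorem integral_mul_abs_sub_equilibrium_le (hm0 : 0 < m) (hm1 : m < 1) (hw : IsConfining R w)
    (hp : IntegrableOn (fun x => equilibrium m (w x)) (Metric.ball 0 R)) {δ : ℝ} (hδ : 0 < δ) :
    ∃ C, 0 ≤ C ∧ ∀ f : E n → ℝ, IntegrableOn f (Metric.ball 0 R) →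
      (∀ᵐ x ∂volume.restrict (Metric.ball 0 R), 0 ≤ f x) →
      ∫ x in Metric.ball 0 R, w x * |f x - equilibrium m (w x)| ≤
        δ + C * ((∫ x in Metric.ball 0 R, energyDensity m (w x) (f x)) -
          ∫ x in Metric.ball 0 R, energyDensity m (w x) (equilibrium m (w x))) := by
  have hp0 : ∀ᵐ x ∂volume.restrict (Metric.ball (0 : E n) R), 0 ≤ equilibrium m (w x) :=
    (hw.ae_equilibrium_pos hm0 hm1).mono fun _ h => h.le
  have hwp := integrableOn_ball_mul hw.continuousOn hp
  set I := ∫ x in Metric.ball 0 R, w x * equilibrium m (w x) with hI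
  have hI0 : 0 ≤ I := integral_nonneg_of_ae (by
    filter_upwards [hp0, hw.ae_pos] with x h1 h2
    exact mul_nonneg h2.le h1)
  -- Integrating the slack gives `δ / (I + 1) * I ≤ δ`; the `+ 1` avoids a case distinction at `I =
  -- 0`.
  obtain ⟨C, hC, h⟩ := mul_abs_sub_equilibrium_le hm0 hm1 (δ := δ / (I + 1)) (by positivity)
  refine ⟨C, hC, fun f hf h0 => ?_⟩
  have i1 := integrableOn_energyDensity hm0 hm1 hw.continuousOn hf h0
  have i2 := integrableOn_energyDensity hm0 hm1 hw.continuousOn hp hp0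
  have i3 := integrableOn_ball_mul hw.continuousOn (hf.sub hp).abs
  have i4 : IntegrableOn (fun x => C * (energyDensity m (w x) (f x) -
      energyDensity m (w x) (equilibrium m (w x)))) (Metric.ball 0 R) := (i1.sub i2).const_mul C
  have : ∫ x in Metric.ball 0 R, w x * |f x - equilibrium m (w x)| ≤
      ∫ x in Metric.ball 0 R, (δ / (I + 1) * (w x * equilibrium m (w x)) +
        C * (energyDensity m (w x) (f x) - energyDensity m (w x) (equilibrium m (w x)))) := by
    refine integral_mono_ae i3 ((hwp.const_mul _).add i4) ?_
    filter_upwards [hw.ae_pos, h0] with x hx hfx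
    exact h _ _ hx hfx
  rw [integral_add (hwp.const_mul _) i4, integral_const_mul,
    integral_const_mul, integral_sub i1 i2, ← hI] at this
  refine this.trans (add_le_add_left ?_ _)
  rw [div_mul_eq_mul_div, div_le_iff₀ (by positivity)]
  nlinarith

/-- With zero excess, the weighted distance is at most every `δ > 0`, hence zero, and the weight is
positive almost everywhere. -/
theorem ae_eq_equilibrium (hm0 : 0 < m) (hm1 : m < 1) (hw : IsConfining R w)
    (hp : IntegrableOn (fun x => equilibrium m (w x)) (Metric.ball 0 R))
    (hf : IntegrableOn f (Metric.ball 0 R))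
    (h0 : ∀ᵐ x ∂volume.restrict (Metric.ball 0 R), 0 ≤ f x)
    (he : ∫ x in Metric.ball 0 R, energyDensity m (w x) (f x) =
      ∫ x in Metric.ball 0 R, energyDensity m (w x) (equilibrium m (w x))) :
    ∀ᵐ x ∂volume.restrict (Metric.ball 0 R), f x = equilibrium m (w x) := by
  have hle : ∫ x in Metric.ball 0 R, w x * |f x - equilibrium m (w x)| ≤ 0 := by
    refine le_of_forall_pos_le_add fun δ hδ => ?_
    obtain ⟨C, -, h⟩ := integral_mul_abs_sub_equilibrium_le hm0 hm1 hw hp hδ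
    have := h f hf h0
    rw [he, sub_self, mul_zero] at this
    linarith
  have hnn : 0 ≤ᵐ[volume.restrict (Metric.ball 0 R)]
      fun x => w x * |f x - equilibrium m (w x)| :=
    hw.ae_pos.mono fun x hx => mul_nonneg hx.le (abs_nonneg _)
  have := (integral_eq_zero_iff_of_nonneg_ae hnn
    (integrableOn_ball_mul hw.continuousOn (hf.sub hp).abs)).1
    (le_antisymm hle (integral_nonneg_of_ae hnn))
  filter_upwards [this, hw.ae_pos] with x hx hwx
  have h' := (mul_eq_zero.1 hx).resolve_left hwx.ne'
  exact sub_eq_zero.1 (abs_eq_zero.1 h')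

end Excess

end FastDiffusion

/-! ### Equilibrium measures as unique minimisers of the relaxed energy. -/

namespace FastDiffusion

variable {n : ℕ} {m R c mass : ℝ} {w f : E n → ℝ}

/-- The measure with density `equilibrium m w` on the ball and an atom of mass `c` at `0`. -/
noncomputable def equilibriumMeasure (m R : ℝ) (w : E n → ℝ) (c : ℝ) : Measure (E n) :=
  ENNReal.ofReal c • Measure.dirac 0 +
    (volume.restrict (Metric.ball 0 R)).withDensity fun x => ENNReal.ofReal (equilibrium m (w x))

theorem setIntegral_smul_dirac_zero (hR : 0 < R) (hc : 0 ≤ c) (φ : E n → ℝ) :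
    ∫ x in Metric.closedBall 0 R, φ x ∂(ENNReal.ofReal c • Measure.dirac (0 : E n)) = c * φ 0 := by
  rw [Measure.restrict_smul, integral_smul_measure, Measure.restrict_eq_self_of_ae_mem,
    integral_dirac, ENNReal.toReal_ofReal hc, smul_eq_mul]
  exact (ae_dirac_iff Metric.isClosed_closedBall.measurableSet).2
    (Metric.mem_closedBall_self hR.le)

theorem lintegral_equilibrium [Nontrivial (E n)] (hm0 : 0 < m) (hm1 : m < 1)
    (hw : IsConfining R w)
    (hp : IntegrableOn (fun x => equilibrium m (w x)) (Metric.ball 0 R)) :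
    ∫⁻ x in Metric.ball 0 R, ENNReal.ofReal (equilibrium m (w x)) =
      ENNReal.ofReal (∫ x in Metric.ball 0 R, equilibrium m (w x)) :=
  (ofReal_integral_eq_lintegral_ofReal hp
    ((hw.ae_equilibrium_pos hm0 hm1).mono fun _ h => h.le)).symm

theorem integral_equilibrium_nonneg [Nontrivial (E n)] (hm0 : 0 < m) (hm1 : m < 1)
    (hw : IsConfining R w) : 0 ≤ ∫ x in Metric.ball 0 R, equilibrium m (w x) :=
  integral_nonneg_of_ae ((hw.ae_equilibrium_pos hm0 hm1).mono fun _ h => h.le)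

theorem equilibriumMeasure_mem_measures [Nontrivial (E n)] (hm0 : 0 < m) (hm1 : m < 1)
    (hR : 0 < R) (hw : IsConfining R w)
    (hp : IntegrableOn (fun x => equilibrium m (w x)) (Metric.ball 0 R)) (hc : 0 ≤ c)
    (hmass : c + ∫ x in Metric.ball 0 R, equilibrium m (w x) = mass) :
    equilibriumMeasure m R w c ∈ measures n R mass := by
  have hK : MeasurableSet (Metric.closedBall (0 : E n) R)ᶜ :=
    Metric.isClosed_closedBall.measurableSet.compl
  constructor
  · have h2 : (volume.restrict (Metric.ball (0 : E n) R)) (Metric.closedBall 0 R)ᶜ = 0 := by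
      rw [Measure.restrict_apply hK, (disjoint_compl_left_iff_subset.2
        Metric.ball_subset_closedBall).inter_eq, measure_empty]
    simp [equilibriumMeasure, withDensity_absolutelyContinuous _ _ h2, hK, hR.le]
  · simp only [equilibriumMeasure, Measure.add_apply, Measure.smul_apply, measure_univ,
      smul_eq_mul, mul_one, withDensity_apply _ MeasurableSet.univ, Measure.restrict_univ]
    rw [lintegral_equilibrium hm0 hm1 hw hp,
      ← ENNReal.ofReal_add hc (integral_equilibrium_nonneg hm0 hm1 hw), hmass]

theorem aemeasurable_indicator_equilibrium
    (hp : IntegrableOn (fun x => equilibrium m (w x)) (Metric.ball 0 R)) :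
    AEMeasurable ((Metric.ball 0 R).indicator fun x => ENNReal.ofReal (equilibrium m (w x)))
      (volume : Measure (E n)) :=
  (aemeasurable_indicator_iff measurableSet_ball).2 hp.aestronglyMeasurable.aemeasurable.ennreal_ofReal

theorem equilibriumMeasure_eq :
    equilibriumMeasure m R w c = ENNReal.ofReal c • Measure.dirac 0 + volume.withDensity
      ((Metric.ball 0 R).indicator fun x => ENNReal.ofReal (equilibrium m (w x))) := by
  rw [withDensity_indicator measurableSet_ball, equilibriumMeasure]

theorem smul_dirac_mutuallySingular [Nontrivial (E n)] (a : ℝ≥0∞) (x : E n) :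
    (a • Measure.dirac x) ⟂ₘ (volume : Measure (E n)) :=
  (mutuallySingular_dirac x volume).smul a

theorem rnDeriv_equilibriumMeasure [Nontrivial (E n)]
    (hp : IntegrableOn (fun x => equilibrium m (w x)) (Metric.ball 0 R)) :
    (Metric.ball 0 R).indicator (fun x => ENNReal.ofReal (equilibrium m (w x))) =ᵐ[volume]
      (equilibriumMeasure m R w c).rnDeriv volume :=
  Measure.eq_rnDeriv₀ (aemeasurable_indicator_equilibrium hp)
    (smul_dirac_mutuallySingular _ 0) equilibriumMeasure_eq

theorem singularPart_equilibriumMeasure [Nontrivial (E n)]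
    (hp : IntegrableOn (fun x => equilibrium m (w x)) (Metric.ball 0 R)) :
    (equilibriumMeasure m R w c).singularPart volume = ENNReal.ofReal c • Measure.dirac 0 := by
  have h := aemeasurable_indicator_equilibrium hp
  refine (Measure.eq_singularPart h.measurable_mk (smul_dirac_mutuallySingular _ 0) ?_).symm
  rw [equilibriumMeasure_eq, withDensity_congr_ae h.ae_eq_mk]

/-- The condition `c * w 0 = 0` is complementary slackness: an atom is present only where it costs
nothing. -/
theorem relaxedEnergy_equilibriumMeasure [Nontrivial (E n)] (hm0 : 0 < m) (hm1 : m < 1)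
    (hR : 0 < R) (hw : IsConfining R w)
    (hp : IntegrableOn (fun x => equilibrium m (w x)) (Metric.ball 0 R)) (hc : 0 ≤ c)
    (hcw : c * w 0 = 0) :
    relaxedEnergy m R w (equilibriumMeasure m R w c) =
      ∫ x in Metric.ball 0 R, energyDensity m (w x) (equilibrium m (w x)) := by
  have : IsFiniteMeasure (equilibriumMeasure m R w c) := ⟨by
    rw [(equilibriumMeasure_mem_measures hm0 hm1 hR hw hp hc rfl).2]
    exact ENNReal.ofReal_lt_top⟩
  rw [relaxedEnergy_eq hm0 hm1 hR hw.continuousOn, singularPart_equilibriumMeasure hp]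
  rw [setIntegral_smul_dirac_zero hR hc, hcw, add_zero]
  refine integral_congr_ae ?_
  filter_upwards [ae_restrict_of_ae (rnDeriv_equilibriumMeasure (c := c) hp),
    ae_restrict_mem measurableSet_ball, hw.ae_equilibrium_pos hm0 hm1] with x hx hxB hx0
  rw [← hx, indicator_of_mem hxB, ENNReal.toReal_ofReal hx0.le]

theorem setIntegral_equilibriumMeasure [Nontrivial (E n)] (hm0 : 0 < m) (hm1 : m < 1)
    (hR : 0 < R) (hw : IsConfining R w)
    (hp : IntegrableOn (fun x => equilibrium m (w x)) (Metric.ball 0 R)) (hc : 0 ≤ c)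
    {φ : E n → ℝ} (hφ : ContinuousOn φ (Metric.closedBall 0 R)) :
    ∫ x in Metric.closedBall 0 R, φ x ∂(equilibriumMeasure m R w c) =
      c * φ 0 + ∫ x in Metric.ball 0 R, φ x * equilibrium m (w x) := by
  have hfin : IsFiniteMeasure (equilibriumMeasure m R w c) := ⟨by
    rw [(equilibriumMeasure_mem_measures hm0 hm1 hR hw hp hc rfl).2]
    exact ENNReal.ofReal_lt_top⟩
  have hI : IntegrableOn φ (Metric.closedBall 0 R) (equilibriumMeasure m R w c) :=
    hφ.integrableOn_compact (isCompact_closedBall _ _)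
  unfold equilibriumMeasure at hI ⊢
  rw [Measure.restrict_add, integral_add_measure (hI.mono_measure (Measure.le_add_right le_rfl))
    (hI.mono_measure (Measure.le_add_left le_rfl))]
  congr 1
  · exact setIntegral_smul_dirac_zero hR hc φ
  · rw [restrict_withDensity Metric.isClosed_closedBall.measurableSet,
      Measure.restrict_restrict Metric.isClosed_closedBall.measurableSet,
      inter_eq_right.2 Metric.ball_subset_closedBall,
      integral_withDensity_eq_integral_toReal_smul₀
        hp.aestronglyMeasurable.aemeasurable.ennreal_ofReal (by simp)]
    refine integral_congr_ae ?_
    filter_upwards [hw.ae_equilibrium_pos hm0 hm1] with x hx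
    simp [ENNReal.toReal_ofReal hx.le, mul_comm]

theorem integral_equilibrium_le_relaxedEnergy [Nontrivial (E n)] (hm0 : 0 < m) (hm1 : m < 1)
    (hR : 0 < R) (hw : IsConfining R w)
    (hp : IntegrableOn (fun x => equilibrium m (w x)) (Metric.ball 0 R)) (ν : Measure (E n))
    [IsFiniteMeasure ν] :
    ∫ x in Metric.ball 0 R, energyDensity m (w x) (equilibrium m (w x)) ≤
      relaxedEnergy m R w ν := by
  rw [relaxedEnergy_eq hm0 hm1 hR hw.continuousOn]
  have h1 := integral_energyDensity_equilibrium_le hm0 hm1 hw hp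
    (Measure.integrable_toReal_rnDeriv (μ := ν) (ν := volume)).integrableOn
    (ae_of_all _ fun _ => ENNReal.toReal_nonneg)
  have h2 : 0 ≤ ∫ x in Metric.closedBall 0 R, w x ∂(ν.singularPart volume) :=
    setIntegral_nonneg Metric.isClosed_closedBall.measurableSet fun x hx => hw.nonneg hx
  linarith

/-- A finite measure attaining the lower bound of the relaxed energy is an equilibrium measure. -/
theorem eq_equilibriumMeasure_of_relaxedEnergy [Nontrivial (E n)] (hm0 : 0 < m) (hm1 : m < 1)
    (hR : 0 < R) (hw : IsConfining R w)
    (hp : IntegrableOn (fun x => equilibrium m (w x)) (Metric.ball 0 R)) (hc : 0 ≤ c)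
    (hmass : c + ∫ x in Metric.ball 0 R, equilibrium m (w x) = mass)
    {ν : Measure (E n)} (hν : ν ∈ measures n R mass)
    (he : relaxedEnergy m R w ν =
      ∫ x in Metric.ball 0 R, energyDensity m (w x) (equilibrium m (w x))) :
    ν = equilibriumMeasure m R w c := by
  have hfin : IsFiniteMeasure ν := ⟨by rw [hν.2]; exact ENNReal.ofReal_lt_top⟩
  set σ := ν.singularPart volume with hσ
  have hf : IntegrableOn (fun x => (ν.rnDeriv volume x).toReal) (Metric.ball 0 R) volume :=
    (Measure.integrable_toReal_rnDeriv (μ := ν) (ν := volume)).integrableOn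
  have hf0 : ∀ᵐ x ∂volume.restrict (Metric.ball 0 R), 0 ≤ (ν.rnDeriv volume x).toReal :=
    ae_of_all _ fun _ => ENNReal.toReal_nonneg
  have h1 := integral_energyDensity_equilibrium_le hm0 hm1 hw hp hf hf0
  have hnn : 0 ≤ᵐ[σ.restrict (Metric.closedBall 0 R)] w :=
    ae_restrict_of_forall_mem Metric.isClosed_closedBall.measurableSet fun x hx => hw.nonneg hx
  have h2 : 0 ≤ ∫ x in Metric.closedBall 0 R, w x ∂σ := integral_nonneg_of_ae hnn
  rw [relaxedEnergy_eq hm0 hm1 hR hw.continuousOn] at he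
  -- Both the excess of the density and the singular cost are nonnegative and their sum vanishes, so
  -- each vanishes.
  have hae := ae_eq_equilibrium hm0 hm1 hw hp hf hf0 (by linarith)
  have hs0 : ∫ x in Metric.closedBall 0 R, w x ∂σ = 0 := by linarith
  have hsw := (integral_eq_zero_iff_of_nonneg_ae hnn
    (hw.continuousOn.integrableOn_compact (isCompact_closedBall _ _))).1 hs0
  have hσK : ∀ᵐ x ∂σ, x ∈ Metric.closedBall (0 : E n) R :=
    (Measure.singularPart_le ν volume).absolutelyContinuous hν.1
  have hσ0 : ∀ᵐ x ∂σ, x = 0 := by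
    rw [Filter.EventuallyEq, ae_restrict_iff' Metric.isClosed_closedBall.measurableSet] at hsw
    filter_upwards [hsw, hσK] with x hx hxK
    by_contra h
    exact (hw.pos x hxK h).ne' (hx hxK)
  have hσd : σ = σ univ • Measure.dirac 0 := by
    have : σ = σ.restrict {0} := (Measure.restrict_eq_self_of_ae_mem hσ0).symm
    rw [Measure.restrict_singleton] at this
    nth_rewrite 1 [this]
    congr 1
    exact measure_eq_measure_of_null_sdiff (subset_univ _) 
      (by rw [← compl_eq_univ_sdiff]; exact hσ0)
  have hdens : (volume : Measure (E n)).withDensity (ν.rnDeriv volume) =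
      (volume.restrict (Metric.ball 0 R)).withDensity
        fun x => ENNReal.ofReal (equilibrium m (w x)) := by
    have hK : ((volume : Measure (E n)).withDensity (ν.rnDeriv volume)) (Metric.closedBall 0 R)ᶜ
        = 0 := (Measure.withDensity_rnDeriv_le ν volume).absolutelyContinuous hν.1
    rw [← Measure.restrict_eq_self_of_ae_mem (μ := (volume : Measure (E n)).withDensity
        (ν.rnDeriv volume)) (s := Metric.closedBall 0 R) hK,
      restrict_withDensity Metric.isClosed_closedBall.measurableSet,
      ← Measure.restrict_congr_set (ball_ae_eq_closedBall hR)]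
    refine withDensity_congr_ae ?_
    filter_upwards [hae, ae_restrict_of_ae (Measure.rnDeriv_lt_top ν volume)] with x hx hxt
    rw [← hx, ENNReal.ofReal_toReal hxt.ne]
  have hdec : ν = σ univ • Measure.dirac 0 +
      (volume.restrict (Metric.ball 0 R)).withDensity
        fun x => ENNReal.ofReal (equilibrium m (w x)) := by
    rw [← hσd, ← hdens]
    exact Measure.haveLebesgueDecomposition_add ν volume
  -- Only the coefficient of the Dirac mass is still unknown; comparing total masses determines it.
  have htot := congrArg (fun μ : Measure (E n) => μ univ) hdec
  have hμ := (equilibriumMeasure_mem_measures hm0 hm1 hR hw hp hc hmass).2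
  simp only [equilibriumMeasure, Measure.add_apply, Measure.smul_apply, measure_univ, smul_eq_mul,
    mul_one, withDensity_apply _ MeasurableSet.univ, Measure.restrict_univ] at htot hμ
  rw [hν.2, ← hμ, lintegral_equilibrium hm0 hm1 hw hp] at htot
  rw [equilibriumMeasure, (ENNReal.add_left_inj ENNReal.ofReal_ne_top).1 htot]
  exact hdec

end FastDiffusion

/-! ### Approximation by densities and weak-⋆ convergence. -/

namespace FastDiffusion

variable {n : ℕ} {m R c mass : ℝ} {w f : E n → ℝ}

/-- The power term only decreases when mass is added, so added mass costs at most its potential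
energy. -/
theorem energyDensity_add_le {m w s t : ℝ} (hm0 : 0 < m) (hm1 : m < 1) (hs : 0 ≤ s) (ht : 0 ≤ t) :
    energyDensity m w (s + t) ≤ energyDensity m w s + w * t := by
  have h1 : 0 < 1 - m := by linarith
  have := mul_le_mul_of_nonneg_left
    (Real.rpow_le_rpow hs (le_add_of_nonneg_right ht) hm0.le) (by positivity : 0 ≤ 1 / (1 - m))
  unfold energyDensity
  linarith

/-- Spreading the atom over small balls gives densities of almost minimal energy. -/
theorem exists_density_energy_le [Nontrivial (E n)] (hm0 : 0 < m) (hm1 : m < 1)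
    (hR : 0 < R) (hw : IsConfining R w)
    (hp : IntegrableOn (fun x => equilibrium m (w x)) (Metric.ball 0 R)) (hc : 0 ≤ c)
    (hcw : c * w 0 = 0) (hmass : c + ∫ x in Metric.ball 0 R, equilibrium m (w x) = mass)
    {ε : ℝ} (hε : 0 < ε) :
    ∃ ρ ∈ densities n R mass, ∫ x in Metric.ball 0 R, energyDensity m (w x) (ρ x) ≤
      (∫ x in Metric.ball 0 R, energyDensity m (w x) (equilibrium m (w x))) + ε := by
  obtain ⟨d', hd', hball⟩ := Metric.continuousAt_iff.1
    (hw.continuousOn.continuousAt (Metric.closedBall_mem_nhds _ hR)) (ε / (c + 1)) (by positivity)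
  set d := min d' R
  have hd : 0 < d := lt_min hd' hR
  set D := Metric.ball (0 : E n) d
  have hDB : D ⊆ Metric.ball 0 R := Metric.ball_subset_ball (min_le_right _ _)
  have hvol : 0 < volume.real D :=
    ENNReal.toReal_pos (Metric.measure_ball_pos volume _ hd).ne' measure_ball_lt_top.ne
  -- The atom is spread uniformly over `D`, where `w` exceeds `w 0` by less than `ε / (c + 1)`. Its
  -- cost is then at most `c * w 0 + ε * c / (c + 1) ≤ ε`.
  set q : E n → ℝ := D.indicator fun _ => c / volume.real D
  have hq0 : ∀ x, 0 ≤ q x := fun x => indicator_nonneg (fun _ _ => by positivity) x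
  have hq : IntegrableOn q (Metric.ball 0 R) :=
    ((integrableOn_const (measure_ball_lt_top (μ := volume)).ne).integrable_indicator
      measurableSet_ball).integrableOn
  have hqi : ∫ x in Metric.ball 0 R, q x = c := by
    rw [setIntegral_indicator measurableSet_ball, inter_eq_right.2 hDB, setIntegral_const,
      smul_eq_mul, mul_div_cancel₀ _ hvol.ne']
  have hp0 : ∀ᵐ x ∂volume.restrict (Metric.ball (0 : E n) R), 0 ≤ equilibrium m (w x) :=
    (hw.ae_equilibrium_pos hm0 hm1).mono fun _ h => h.le
  have hs0 : ∀ᵐ x ∂volume.restrict (Metric.ball (0 : E n) R), 0 ≤ equilibrium m (w x) + q x :=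
    hp0.mono fun x hx => add_nonneg hx (hq0 x)
  refine ⟨fun x => equilibrium m (w x) + q x, ⟨hp.add hq, hs0, ?_⟩, ?_⟩
  · rw [integral_add hp hq, hqi, ← hmass, add_comm]
  have i1 := integrableOn_energyDensity hm0 hm1 hw.continuousOn hp hp0
  have i2 := integrableOn_energyDensity hm0 hm1 hw.continuousOn (hp.add hq) hs0
  have hle : ∫ x in Metric.ball 0 R, energyDensity m (w x) (equilibrium m (w x) + q x) ≤
      ∫ x in Metric.ball 0 R,
        (energyDensity m (w x) (equilibrium m (w x)) + (w 0 + ε / (c + 1)) * q x) := by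
    refine integral_mono_ae i2 (i1.add (hq.const_mul _)) ?_
    filter_upwards [hp0] with x hx
    refine (energyDensity_add_le hm0 hm1 hx (hq0 x)).trans (add_le_add_right ?_ _)
    by_cases hxD : x ∈ D
    · refine mul_le_mul_of_nonneg_right ?_ (hq0 x)
      have := hball ((Metric.mem_ball.1 hxD).trans_le (min_le_left _ _))
      rw [Real.dist_eq] at this
      linarith [le_abs_self (w x - w 0)]
    · simp [q, indicator_of_notMem hxD]
  rw [integral_add i1 (hq.const_mul _), integral_const_mul, hqi] at hle
  refine hle.trans (add_le_add_right ?_ _)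
  have : ε / (c + 1) * c ≤ ε := by
    rw [div_mul_eq_mul_div, div_le_iff₀ (by positivity)]
    nlinarith
  linarith

/-- The set where `|φ - φ 0| ≥ ε` is compact and avoids `0`, so `w` has a positive minimum there and
a multiple of `w` dominates. -/
theorem IsConfining.exists_abs_sub_le (hw : IsConfining R w) {φ : E n → ℝ}
    (hφ : ContinuousOn φ (Metric.closedBall 0 R)) {ε : ℝ} (hε : 0 < ε) :
    ∃ C, 0 ≤ C ∧ ∀ x ∈ Metric.closedBall 0 R, |φ x - φ 0| ≤ ε + C * w x := by
  have hψ : ContinuousOn (fun x => |φ x - φ 0|) (Metric.closedBall 0 R) :=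
    (hφ.sub continuousOn_const).abs
  obtain ⟨M, hM⟩ := (isCompact_closedBall (0 : E n) R).exists_bound_of_continuousOn hψ
  set S := Metric.closedBall (0 : E n) R ∩ (fun x => |φ x - φ 0|) ⁻¹' Ici ε with hS
  have hSc : IsCompact S := (isCompact_closedBall (0 : E n) R).of_isClosed_subset
    (hψ.preimage_isClosed_of_isClosed Metric.isClosed_closedBall isClosed_Ici) inter_subset_left
  have hout : ∀ x ∈ Metric.closedBall 0 R, x ∉ S → |φ x - φ 0| ≤ ε := fun x hx hxS => by
    by_contra h
    exact hxS ⟨hx, (not_le.1 h).le⟩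
  rcases S.eq_empty_or_nonempty with he | hne
  · exact ⟨0, le_rfl, fun x hx => by simpa using hout x hx (by simp [he])⟩
  obtain ⟨y, hy, hmin⟩ := hSc.exists_isMinOn hne (hw.continuousOn.mono inter_subset_left)
  have hwy : 0 < w y := hw.pos y hy.1 (by
    rintro rfl
    have : ε ≤ |φ 0 - φ 0| := hy.2
    simp at this
    linarith)
  have hM0 : 0 ≤ M := (norm_nonneg _).trans (hM y hy.1)
  refine ⟨M / w y, by positivity, fun x hx => ?_⟩
  have hwx := hw.nonneg hx
  by_cases hxS : x ∈ S
  · have h1 : |φ x - φ 0| ≤ M := by simpa using hM x hx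
    have h2 : M ≤ M / w y * w x := by
      rw [div_mul_eq_mul_div, le_div_iff₀ hwy]
      exact mul_le_mul_of_nonneg_left (hmin hxS) hM0
    linarith
  · have := hout x hx hxS
    have : 0 ≤ M / w y * w x := by positivity
    linarith

/-- Unweighted `L¹` convergence to `p` is impossible when `c > 0`. Convergence holds in the weight
`w`, and the mass escaping this weight can only collect at `0`, where `φ - φ 0` is small. -/
theorem tendstoWeakStar_equilibriumMeasure [Nontrivial (E n)] (hm0 : 0 < m) (hm1 : m < 1)
    (hR : 0 < R) (hw : IsConfining R w)
    (hp : IntegrableOn (fun x => equilibrium m (w x)) (Metric.ball 0 R)) (hc : 0 ≤ c)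
    (hmass : c + ∫ x in Metric.ball 0 R, equilibrium m (w x) = mass)
    {ρ : ℕ → E n → ℝ} (hρ : ∀ j, ρ j ∈ densities n R mass)
    (hlim : Tendsto (fun j => ∫ x in Metric.ball 0 R, energyDensity m (w x) (ρ j x)) atTop
      (𝓝 (∫ x in Metric.ball 0 R, energyDensity m (w x) (equilibrium m (w x))))) :
    TendstoWeakStar R ρ (equilibriumMeasure m R w c) := by
  have hp0 : ∀ᵐ x ∂volume.restrict (Metric.ball (0 : E n) R), 0 ≤ equilibrium m (w x) :=
    (hw.ae_equilibrium_pos hm0 hm1).mono fun _ h => h.le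
  have hp1 := integral_equilibrium_nonneg hm0 hm1 hw
  have hmass0 : 0 ≤ mass := by linarith
  have hweight : ∀ η > 0, ∀ᶠ j in atTop,
      ∫ x in Metric.ball 0 R, w x * |ρ j x - equilibrium m (w x)| < η := by
    intro η hη
    obtain ⟨C, hC, h⟩ := integral_mul_abs_sub_equilibrium_le hm0 hm1 hw hp (half_pos hη)
    have ht := (hlim.sub_const
      (∫ x in Metric.ball 0 R, energyDensity m (w x) (equilibrium m (w x)))).const_mul C
    rw [sub_self, mul_zero] at ht
    filter_upwards [ht.eventually (gt_mem_nhds (half_pos hη))] with j hj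
    linarith [h (ρ j) (hρ j).1 (hρ j).2.1]
  intro φ hφ
  rw [setIntegral_equilibriumMeasure hm0 hm1 hR hw hp hc hφ, Metric.tendsto_atTop']
  intro η hη
  -- The `L¹` distance is at most `2 * mass`, so this choice costs at most `η / 2`; the weighted
  -- term below gets the other half.
  obtain ⟨C, hC, hφC⟩ := hw.exists_abs_sub_le hφ (ε := η / (4 * (mass + 1))) (by positivity)
  obtain ⟨N, hN⟩ := eventually_atTop.1 (hweight (η / (2 * (C + 1))) (by positivity))
  refine ⟨N, fun j hj => ?_⟩
  obtain ⟨hi, hnn, hmj⟩ := hρ j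
  have iD : IntegrableOn (fun x => ρ j x - equilibrium m (w x)) (Metric.ball 0 R) := hi.sub hp
  have iφ := integrableOn_ball_mul hφ hi
  have iφp := integrableOn_ball_mul hφ hp
  have iφd : IntegrableOn (fun x => φ x * ρ j x - φ x * equilibrium m (w x)) (Metric.ball 0 R) :=
    iφ.sub iφp
  -- Since `∫ (ρ j - p) = c`, subtracting the constant `φ 0` from `φ` accounts exactly for the atom.
  have key : (∫ x in Metric.ball 0 R, φ x * ρ j x) -
      (c * φ 0 + ∫ x in Metric.ball 0 R, φ x * equilibrium m (w x)) =
      ∫ x in Metric.ball 0 R, (φ x - φ 0) * (ρ j x - equilibrium m (w x)) := by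
    have e1 : ∀ x, (φ x - φ 0) * (ρ j x - equilibrium m (w x)) =
        (φ x * ρ j x - φ x * equilibrium m (w x)) - φ 0 * (ρ j x - equilibrium m (w x)) :=
      fun x => by ring
    simp_rw [e1]
    rw [integral_sub iφd (iD.const_mul _), integral_sub iφ iφp, integral_const_mul,
      integral_sub hi hp, hmj, ← hmass]
    ring
  have iw := integrableOn_ball_mul hw.continuousOn iD.abs
  have hL1 : ∫ x in Metric.ball 0 R, |ρ j x - equilibrium m (w x)| ≤ 2 * mass := by
    have : ∫ x in Metric.ball 0 R, |ρ j x - equilibrium m (w x)| ≤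
        ∫ x in Metric.ball 0 R, (ρ j x + equilibrium m (w x)) := by
      refine integral_mono_ae iD.abs (hi.add hp) ?_
      filter_upwards [hnn, hp0] with x h1 h2
      exact abs_le.2 ⟨by linarith, by linarith⟩
    rw [integral_add hi hp, hmj] at this
    linarith
  rw [Real.dist_eq, key]
  have iB : IntegrableOn (fun x => η / (4 * (mass + 1)) * |ρ j x - equilibrium m (w x)| +
      C * (w x * |ρ j x - equilibrium m (w x)|)) (Metric.ball 0 R) :=
    (iD.abs.const_mul _).add (iw.const_mul _)
  have hb : |∫ x in Metric.ball 0 R, (φ x - φ 0) * (ρ j x - equilibrium m (w x))| ≤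
      ∫ x in Metric.ball 0 R, (η / (4 * (mass + 1)) * |ρ j x - equilibrium m (w x)| +
        C * (w x * |ρ j x - equilibrium m (w x)|)) := by
    rw [← Real.norm_eq_abs (∫ x in Metric.ball 0 R, (φ x - φ 0) * (ρ j x - equilibrium m (w x)))]
    refine norm_integral_le_of_norm_le iB ?_
    refine ae_restrict_of_forall_mem measurableSet_ball fun x hx => ?_
    rw [norm_mul, Real.norm_eq_abs, Real.norm_eq_abs]
    have := mul_le_mul_of_nonneg_right (hφC x (Metric.ball_subset_closedBall hx))
      (abs_nonneg (ρ j x - equilibrium m (w x)))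
    linarith
  rw [integral_add (iD.abs.const_mul _) (iw.const_mul _), integral_const_mul,
    integral_const_mul] at hb
  have h1 : η / (4 * (mass + 1)) * ∫ x in Metric.ball 0 R, |ρ j x - equilibrium m (w x)|
      ≤ η / 2 := by
    refine (mul_le_mul_of_nonneg_left hL1 (by positivity)).trans ?_
    rw [div_mul_eq_mul_div, div_le_div_iff₀ (by positivity) (by positivity)]
    nlinarith
  have h2 : C * ∫ x in Metric.ball 0 R, w x * |ρ j x - equilibrium m (w x)| < η / 2 := by
    have h3 : (C + 1) * (η / (2 * (C + 1))) = η / 2 := by field_simp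
    have h4 := hN j (hj.le)
    have h5 : 0 ≤ C * (η / (2 * (C + 1))) := by positivity
    have h6 : 0 < η / (2 * (C + 1)) := by positivity
    have := mul_le_mul_of_nonneg_left h4.le hC
    linarith
  linarith

end FastDiffusion

/-! ### The profile mass and the choice of the multiplier `h`. -/

namespace FastDiffusion

variable {n : ℕ} {m R c mass : ℝ} {V : E n → ℝ} {h : ℝ}

theorem profile_antitone (hm1 : m < 1) (hm0 : 0 < m) (x : E n) :
    Antitone fun h => profile m V h x := by
  intro a b hab
  have h1 : 0 < 1 - m := by linarith
  simp only [profile]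
  rw [ENNReal.rpow_neg, ENNReal.rpow_neg, ENNReal.inv_le_inv]
  refine ENNReal.rpow_le_rpow (ENNReal.ofReal_le_ofReal ?_) (by positivity)
  gcongr

theorem continuous_profile (x : E n) : Continuous fun h => profile m V h x := by
  unfold profile
  exact ENNReal.continuous_rpow_const.comp (ENNReal.continuous_ofReal.comp (by fun_prop))

theorem aemeasurable_profile (hV : ContinuousOn V (Metric.closedBall 0 R)) (h : ℝ) :
    AEMeasurable (profile m V h) (volume.restrict (Metric.ball 0 R)) := by
  have : AEMeasurable V (volume.restrict (Metric.ball 0 R)) :=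
    (hV.mono Metric.ball_subset_closedBall).aemeasurable measurableSet_ball
  exact (((this.add_const h).const_mul _).ennreal_ofReal).pow_const _

theorem profile_of_pos (hm0 : 0 < m) (hm1 : m < 1) {x : E n} (hx : 0 < V x + h) :
    profile m V h x = ENNReal.ofReal (equilibrium m (V x + h)) := by
  have h1 : 0 < 1 - m := by linarith
  unfold profile equilibrium
  exact ENNReal.ofReal_rpow_of_pos (by positivity)

theorem profile_of_nonpos (hm0 : 0 < m) (hm1 : m < 1) {x : E n} (hx : V x + h ≤ 0) :
    profile m V h x = ⊤ := by
  have h1 : 0 < 1 - m := by linarith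
  have h2 : 0 < (1 - m) / m := by positivity
  have h3 : 0 < 1 / (1 - m) := by positivity
  unfold profile
  rw [ENNReal.ofReal_of_nonpos (by nlinarith), ENNReal.zero_rpow_of_neg (by linarith)]

theorem profileMass_le (hm0 : 0 < m) (hm1 : m < 1)
    (hV : ∀ x ∈ Metric.ball (0 : E n) R, 0 ≤ V x) (hh : 0 < h) :
    profileMass m R V h ≤
      ENNReal.ofReal (equilibrium m h) * volume (Metric.ball (0 : E n) R) := by
  rw [← setLIntegral_const]
  refine setLIntegral_mono' measurableSet_ball fun x hx => ?_
  have : profile m V h x ≤ profile m (fun _ : E n => 0) h x := by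
    have h1 : 0 < 1 - m := by linarith
    unfold profile
    rw [ENNReal.rpow_neg, ENNReal.rpow_neg, ENNReal.inv_le_inv]
    refine ENNReal.rpow_le_rpow (ENNReal.ofReal_le_ofReal ?_) (by positivity)
    have := hV x hx
    gcongr
  rw [profile_of_pos (V := fun _ => 0) hm0 hm1 (by simpa using hh)] at this
  simpa using this

theorem tendsto_equilibrium_atTop (hm0 : 0 < m) (hm1 : m < 1) :
    Tendsto (equilibrium m) atTop (𝓝 0) := by
  have h1 : 0 < 1 - m := by linarith
  exact (tendsto_rpow_neg_atTop (by positivity : 0 < 1 / (1 - m))).comp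
    (tendsto_id.const_mul_atTop (by positivity : 0 < (1 - m) / m))

theorem exists_profileMass_eq (hm0 : 0 < m) (hm1 : m < 1) (hmass : 0 < mass)
    (hVc : ContinuousOn V (Metric.closedBall 0 R))
    (hV : ∀ x ∈ Metric.ball (0 : E n) R, 0 ≤ V x)
    (hle : ENNReal.ofReal mass ≤ profileMass m R V 0) :
    ∃ h, 0 ≤ h ∧ profileMass m R V h = ENNReal.ofReal mass := by
  rcases hle.eq_or_lt with heq | hlt
  · exact ⟨0, le_rfl, heq.symm⟩
  have hvol : volume (Metric.ball (0 : E n) R) ≠ ⊤ := measure_ball_lt_top.ne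
  -- The mass at `h = 0` may be infinite, so the limit `h → 0` is taken by monotone rather than
  -- dominated convergence.
  have hmono : Tendsto (fun k : ℕ => profileMass m R V (1 / ((k : ℝ) + 1))) atTop
      (𝓝 (profileMass m R V 0)) := by
    refine lintegral_tendsto_of_tendsto_of_monotone (fun k => aemeasurable_profile hVc _)
      (ae_of_all _ fun x => (profile_antitone hm1 hm0 x).comp fun i j hij => ?_)
      (ae_of_all _ fun x => ((continuous_profile x).tendsto 0).comp
        tendsto_one_div_add_atTop_nhds_zero_nat)
    exact Nat.one_div_le_one_div hij
  obtain ⟨k, hk⟩ := (hmono.eventually (lt_mem_nhds hlt)).exists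
  have ha : (0 : ℝ) < 1 / ((k : ℝ) + 1) := Nat.one_div_pos_of_nat
  set a : ℝ := 1 / ((k : ℝ) + 1)
  have hbound : Tendsto (fun h => ENNReal.ofReal (equilibrium m h) *
      volume (Metric.ball (0 : E n) R)) atTop (𝓝 0) := by
    have h1 := ENNReal.tendsto_ofReal (tendsto_equilibrium_atTop hm0 hm1)
    rw [ENNReal.ofReal_zero] at h1
    simpa using ENNReal.Tendsto.mul_const h1 (Or.inr hvol)
  obtain ⟨b, hb, hab⟩ := ((hbound.eventually (gt_mem_nhds (ENNReal.ofReal_pos.2 hmass))).and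
    (eventually_ge_atTop a)).exists
  -- On `[a, b]` the profile at `a > 0` dominates, and it has finite mass.
  have hcont : ContinuousOn (profileMass m R V) (Icc a b) := by
    intro t ht
    refine tendsto_lintegral_filter_of_dominated_convergence' (profile m V a)
      (Eventually.of_forall fun s => aemeasurable_profile hVc s)
      (eventually_mem_nhdsWithin.mono fun s hs => ae_of_all _ fun x =>
        profile_antitone hm1 hm0 x hs.1)
      ((profileMass_le hm0 hm1 hV ha).trans_lt
        (ENNReal.mul_lt_top ENNReal.ofReal_lt_top hvol.lt_top)).ne
      (ae_of_all _ fun x => (continuous_profile x).continuousWithinAt)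
  obtain ⟨h, hh, he⟩ := intermediate_value_Icc' hab hcont
    ⟨((profileMass_le hm0 hm1 hV (ha.trans_le hab)).trans_lt hb).le, hk.le⟩
  exact ⟨h, ha.le.trans hh.1, he⟩

/-- If `V + h ≤ 0` at some `x ≠ 0`, radial monotonicity makes the profile infinite on the whole ball
of radius `‖x‖`, contradicting finite mass. -/
theorem isConfining_add_const (hm0 : 0 < m) (hm1 : m < 1)
    (hVc : ContinuousOn V (Metric.closedBall 0 R)) (hV0 : V 0 = 0)
    (hVincr : ∀ x ∈ Metric.closedBall (0 : E n) R, ∀ y ∈ Metric.closedBall (0 : E n) R,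
      ‖x‖ ≤ ‖y‖ → V x ≤ V y) (hh : 0 ≤ h) (hfin : profileMass m R V h ≠ ⊤) :
    IsConfining R fun x => V x + h where
  continuousOn := hVc.add continuousOn_const
  nonneg_zero := by simpa [hV0] using hh
  pos := by
    intro x hx hx0
    by_contra hneg
    rw [not_lt] at hneg
    refine hfin (top_le_iff.1 ?_)
    have hxR : ‖x‖ ≤ R := by simpa using hx
    calc ⊤ = ⊤ * volume (Metric.ball (0 : E n) ‖x‖) :=
          (ENNReal.top_mul (Metric.measure_ball_pos volume _ (norm_pos_iff.2 hx0)).ne').symm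
      _ = ∫⁻ _ in Metric.ball (0 : E n) ‖x‖, ⊤ := (setLIntegral_const _ _).symm
      _ ≤ ∫⁻ y in Metric.ball (0 : E n) ‖x‖, profile m V h y := by
          refine setLIntegral_mono' measurableSet_ball fun y hy => ?_
          have hy' : ‖y‖ < ‖x‖ := by simpa using hy
          have := hVincr y (by simpa using hy'.le.trans hxR) x hx hy'.le
          rw [profile_of_nonpos hm0 hm1 (by linarith)]
      _ ≤ profileMass m R V h := lintegral_mono_set (Metric.ball_subset_ball hxR)

section Confining

variable [Nontrivial (E n)]

theorem profile_ae_eq (hm0 : 0 < m) (hm1 : m < 1) (hw : IsConfining R fun x => V x + h) :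
    profile m V h =ᵐ[volume.restrict (Metric.ball 0 R)]
      fun x => ENNReal.ofReal (equilibrium m (V x + h)) :=
  hw.ae_pos.mono fun _ hx => profile_of_pos hm0 hm1 hx

theorem integrableOn_equilibrium (hm0 : 0 < m) (hm1 : m < 1)
    (hw : IsConfining R fun x => V x + h) (hfin : profileMass m R V h ≠ ⊤) :
    IntegrableOn (fun x => equilibrium m (V x + h)) (Metric.ball 0 R) := by
  have hmeas : AEMeasurable (fun x => V x + h) (volume.restrict (Metric.ball 0 R)) :=
    (hw.continuousOn.mono Metric.ball_subset_closedBall).aemeasurable measurableSet_ball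
  refine ⟨((hmeas.const_mul _).pow_const _).aestronglyMeasurable, ?_⟩
  rw [hasFiniteIntegral_iff_ofReal ((hw.ae_equilibrium_pos hm0 hm1).mono fun _ h => h.le),
    ← lintegral_congr_ae (profile_ae_eq hm0 hm1 hw)]
  exact hfin.lt_top

theorem profileMass_eq (hm0 : 0 < m) (hm1 : m < 1)
    (hw : IsConfining R fun x => V x + h) (hfin : profileMass m R V h ≠ ⊤) :
    profileMass m R V h = ENNReal.ofReal (∫ x in Metric.ball 0 R, equilibrium m (V x + h)) := by
  rw [← lintegral_equilibrium hm0 hm1 hw (integrableOn_equilibrium hm0 hm1 hw hfin)]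
  exact lintegral_congr_ae (profile_ae_eq hm0 hm1 hw)

theorem profileMeasure_eq (hm0 : 0 < m) (hm1 : m < 1) (hw : IsConfining R fun x => V x + h) :
    profileMeasure m R V h = (volume.restrict (Metric.ball 0 R)).withDensity
      fun x => ENNReal.ofReal (equilibrium m (V x + h)) :=
  withDensity_congr_ae (profile_ae_eq hm0 hm1 hw)

/-- Both cases of the formula have one form, a multiplier `h` and an atom `c` with `c * h = 0`:
either `c = 0`, or `h = 0`. The minimisation argument then needs no case distinction. -/
theorem IsMuInfty.exists_equilibriumMeasure (hm0 : 0 < m) (hm1 : m < 1) (hmass : 0 < mass)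
    (hVc : ContinuousOn V (Metric.closedBall 0 R)) (hV0 : V 0 = 0)
    (hVincr : ∀ x ∈ Metric.closedBall (0 : E n) R, ∀ y ∈ Metric.closedBall (0 : E n) R,
      ‖x‖ ≤ ‖y‖ → V x ≤ V y) {μ : Measure (E n)} (hμ : IsMuInfty m R mass V μ) :
    ∃ h c : ℝ, 0 ≤ c ∧ c * h = 0 ∧ (IsConfining R fun x => V x + h) ∧
      IntegrableOn (fun x => equilibrium m (V x + h)) (Metric.ball 0 R) ∧
      c + ∫ x in Metric.ball 0 R, equilibrium m (V x + h) = mass ∧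
      μ = equilibriumMeasure m R (fun x => V x + h) c := by
  rcases hμ with ⟨h, hh, he, rfl⟩ | ⟨hlt, rfl⟩
  · have hfin : profileMass m R V h ≠ ⊤ := he ▸ ENNReal.ofReal_ne_top
    have hw := isConfining_add_const hm0 hm1 hVc hV0 hVincr hh hfin
    refine ⟨h, 0, le_rfl, zero_mul _, hw, integrableOn_equilibrium hm0 hm1 hw hfin, ?_, ?_⟩
    · rw [profileMass_eq hm0 hm1 hw hfin, ENNReal.ofReal_eq_ofReal_iff
        (integral_equilibrium_nonneg hm0 hm1 hw) hmass.le] at he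
      rw [he, zero_add]
    · rw [equilibriumMeasure, ENNReal.ofReal_zero, zero_smul, zero_add,
        profileMeasure_eq hm0 hm1 hw]
  · have hfin : profileMass m R V 0 ≠ ⊤ := hlt.ne_top
    have hw := isConfining_add_const hm0 hm1 hVc hV0 hVincr le_rfl hfin
    have hI := integral_equilibrium_nonneg hm0 hm1 hw
    rw [profileMass_eq hm0 hm1 hw hfin] at hlt ⊢
    refine ⟨0, mass - ∫ x in Metric.ball 0 R, equilibrium m (V x + 0), ?_, mul_zero _, hw,
      integrableOn_equilibrium hm0 hm1 hw hfin, by ring, ?_⟩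
    · exact sub_nonneg.2 ((ENNReal.ofReal_lt_ofReal_iff hmass).1 hlt).le
    · rw [equilibriumMeasure, profileMeasure_eq hm0 hm1 hw, ENNReal.ofReal_sub _ hI]

end Confining

theorem exists_isMuInfty (hm0 : 0 < m) (hm1 : m < 1) (hmass : 0 < mass)
    (hVc : ContinuousOn V (Metric.closedBall 0 R))
    (hV : ∀ x ∈ Metric.ball (0 : E n) R, 0 ≤ V x) :
    ∃ μ : Measure (E n), IsMuInfty m R mass V μ := by
  rcases lt_or_ge (profileMass m R V 0) (ENNReal.ofReal mass) with h | h
  · exact ⟨_, Or.inr ⟨h, rfl⟩⟩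
  · obtain ⟨a, ha, he⟩ := exists_profileMass_eq hm0 hm1 hmass hVc hV h
    exact ⟨_, Or.inl ⟨a, ha, he, rfl⟩⟩

theorem freeEnergy_add_const (hVc : ContinuousOn V (Metric.closedBall 0 R)) {ρ : E n → ℝ}
    (hρ : ρ ∈ densities n R mass) :
    freeEnergy m R (fun x => V x + h) ρ = freeEnergy m R V ρ + h * mass := by
  unfold freeEnergy
  simp_rw [add_mul]
  rw [integral_add (integrableOn_ball_mul hVc hρ.1) (hρ.1.const_mul h), integral_const_mul,
    hρ.2.2, add_assoc]

theorem relaxedEnergy_add_const (hmass : 0 < mass) (hVc : ContinuousOn V (Metric.closedBall 0 R))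
    {ν : Measure (E n)} (hν : ν ∈ measures n R mass) :
    relaxedEnergy m R (fun x => V x + h) ν = relaxedEnergy m R V ν + h * mass := by
  have hfin : IsFiniteMeasure ν := ⟨by rw [hν.2]; exact ENNReal.ofReal_lt_top⟩
  have hK : ν (Metric.closedBall 0 R) = ENNReal.ofReal mass := by
    rw [← hν.2, ← Measure.restrict_apply_univ, 
      Measure.restrict_eq_self_of_ae_mem (s := Metric.closedBall 0 R) hν.1]
  unfold relaxedEnergy
  rw [integral_add (hVc.integrableOn_compact (isCompact_closedBall _ _))
    (integrable_const _), setIntegral_const, smul_eq_mul, Measure.real, hK,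
    ENNReal.toReal_ofReal hmass.le]
  ring

/-- The minimisation properties of `μ_∞`. -/
theorem IsMuInfty.minimises [Nontrivial (E n)] (hm0 : 0 < m) (hm1 : m < 1) (hR : 0 < R)
    (hmass : 0 < mass) (hVc : ContinuousOn V (Metric.closedBall 0 R)) (hV0 : V 0 = 0)
    (hVincr : ∀ x ∈ Metric.closedBall (0 : E n) R, ∀ y ∈ Metric.closedBall (0 : E n) R,
      ‖x‖ ≤ ‖y‖ → V x ≤ V y) {μ : Measure (E n)} (hμ : IsMuInfty m R mass V μ) :
    (∀ ρ : ℕ → E n → ℝ, IsMinimisingSeq m R mass V ρ → TendstoWeakStar R ρ μ) ∧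
      μ ∈ measures n R mass ∧
      IsLeast (relaxedEnergy m R V '' measures n R mass) (relaxedEnergy m R V μ) ∧
      IsGLB (freeEnergy m R V '' densities n R mass) (relaxedEnergy m R V μ) ∧
      ∀ ν ∈ measures n R mass, relaxedEnergy m R V ν = relaxedEnergy m R V μ → ν = μ := by
  obtain ⟨h, c, hc, hch, hw, hp, hcm, rfl⟩ :=
    hμ.exists_equilibriumMeasure hm0 hm1 hmass hVc hV0 hVincr
  have hcw : c * (V 0 + h) = 0 := by rw [hV0, zero_add, hch]
  have hmem := equilibriumMeasure_mem_measures hm0 hm1 hR hw hp hc hcm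
  have hE := relaxedEnergy_equilibriumMeasure hm0 hm1 hR hw hp hc hcw
  -- From here every energy for `V` is compared with the unconstrained minimum for `V + h`, up to
  -- the common shift `h * mass`.
  rw [relaxedEnergy_add_const hmass hVc hmem] at hE
  set μ := equilibriumMeasure m R (fun x => V x + h) c
  have hfree : ∀ ρ ∈ densities n R mass, freeEnergy m R V ρ + h * mass =
      ∫ x in Metric.ball 0 R, energyDensity m (V x + h) (ρ x) := fun ρ hρ => by
    rw [← freeEnergy_add_const hVc hρ, freeEnergy_eq_integral hm0 hm1 hw.continuousOn hρ]
  have hglb : IsGLB (freeEnergy m R V '' densities n R mass) (relaxedEnergy m R V μ) := by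
    constructor
    · rintro _ ⟨ρ, hρ, rfl⟩
      have := integral_energyDensity_equilibrium_le hm0 hm1 hw hp hρ.1 hρ.2.1
      linarith [hfree ρ hρ]
    · intro b hb
      refine le_of_forall_pos_le_add fun ε hε => ?_
      obtain ⟨ρ, hρ, hle⟩ := exists_density_energy_le hm0 hm1 hR hw hp hc hcw hcm hε
      have := hb ⟨ρ, hρ, rfl⟩
      linarith [hfree ρ hρ]
  refine ⟨?_, hmem, ⟨⟨μ, hmem, rfl⟩, ?_⟩, hglb, ?_⟩
  · rintro ρ ⟨hρ, hlim⟩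
    refine tendstoWeakStar_equilibriumMeasure hm0 hm1 hR hw hp hc hcm hρ ?_
    -- The real `sInf` is the greatest lower bound only for a nonempty set; `ρ 0` supplies an
    -- element.
    rw [hglb.csInf_eq ⟨_, ρ 0, hρ 0, rfl⟩] at hlim
    simpa only [hE, hfree _ (hρ _)] using hlim.add_const (h * mass)
  · rintro _ ⟨ν, hν, rfl⟩
    have : IsFiniteMeasure ν := ⟨by rw [hν.2]; exact ENNReal.ofReal_lt_top⟩
    have := integral_equilibrium_le_relaxedEnergy hm0 hm1 hR hw hp ν
    rw [relaxedEnergy_add_const hmass hVc hν] at this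
    linarith
  · intro ν hν he
    refine eq_equilibriumMeasure_of_relaxedEnergy hm0 hm1 hR hw hp hc hcm hν ?_
    rw [relaxedEnergy_add_const hmass hVc hν, he, hE]

end FastDiffusion

theorem mainTheorem4 (n : ℕ) (hn : 1 ≤ n) (m : ℝ) (hm0 : 0 < m) (hm1 : m < 1)
    (R : ℝ) (hR : 0 < R) (mass : ℝ) (hmass : 0 < mass)
    (V : EuclideanSpace ℝ (Fin n) → ℝ)
    (hVW : FastDiffusion.MemW2Infty (Metric.ball 0 R) V)
    (hVcont : ContinuousOn V (Metric.closedBall 0 R))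
    (hV0 : V 0 = 0)
    (hVincr : ∀ x ∈ Metric.closedBall (0 : EuclideanSpace ℝ (Fin n)) R,
      ∀ y ∈ Metric.closedBall (0 : EuclideanSpace ℝ (Fin n)) R, ‖x‖ ≤ ‖y‖ → V x ≤ V y) :
    (∃! μ : Measure (EuclideanSpace ℝ (Fin n)), FastDiffusion.IsMuInfty m R mass V μ) ∧
    ∀ μ : Measure (EuclideanSpace ℝ (Fin n)), FastDiffusion.IsMuInfty m R mass V μ →
      (∀ ρ : ℕ → EuclideanSpace ℝ (Fin n) → ℝ,
        FastDiffusion.IsMinimisingSeq m R mass V ρ → FastDiffusion.TendstoWeakStar R ρ μ) ∧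
      μ ∈ FastDiffusion.measures n R mass ∧
      IsLeast (FastDiffusion.relaxedEnergy m R V '' FastDiffusion.measures n R mass)
        (FastDiffusion.relaxedEnergy m R V μ) ∧
      IsGLB (FastDiffusion.freeEnergy m R V '' FastDiffusion.densities n R mass)
        (FastDiffusion.relaxedEnergy m R V μ) ∧
      (∀ ν ∈ FastDiffusion.measures n R mass,
        FastDiffusion.relaxedEnergy m R V ν = FastDiffusion.relaxedEnergy m R V μ → ν = μ) := by
  have : NeZero n := ⟨by omega⟩
  -- In positive dimension points are Lebesgue null: the Dirac mass is singular, and `w > 0` off the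
  -- origin means almost everywhere.
  have : Nontrivial (FastDiffusion.E n) := inferInstance
  have hnonneg : ∀ x ∈ Metric.ball (0 : FastDiffusion.E n) R, 0 ≤ V x := fun x hx => by
    rw [← hV0]
    exact hVincr 0 (Metric.mem_closedBall_self hR.le) x (Metric.ball_subset_closedBall hx)
      (by simp)
  have key := fun (μ : Measure (FastDiffusion.E n))
    (hμ : FastDiffusion.IsMuInfty m R mass V μ) =>
      hμ.minimises hm0 hm1 hR hmass hVcont hV0 hVincr
  refine ⟨?_, key⟩
  obtain ⟨μ, hμ⟩ := FastDiffusion.exists_isMuInfty hm0 hm1 hmass hVcont hnonneg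
  refine ⟨μ, hμ, fun ν hν => ?_⟩
  -- Any two measures given by the formula have the least relaxed energy, so uniqueness of the
  -- minimiser identifies them, including across different values of `h`.
  exact (key μ hμ).2.2.2.2 ν (key ν hν).2.1 ((key ν hν).2.2.1.unique (key μ hμ).2.2.1)
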